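/- All graphs are finite, simple and connected, with at least two vertices. A set $X$ of vertices of $G$ is a nonlocal resolving set if for any two distinct non-adjacent vertices $u,v$ of $G$ there is $x\in X$ with $d_G(u,x)\neq d_G(v,x)$; the nonlocal metric dimension $\dim_{\mathrm{n}\ell}(G)$ is the smallest cardinality of a nonlocal resolving set. The edge cover number $\beta'(G)$ is the smallest number of edges of $G$ such that each vertex of $G$ is incident with at least one of them. Theorem. If $G$ is a graph of girth at least $7$ (where an acyclic graph has girth $\infty$), then $$\dim_{\mathrm{n}\ell}(G)\le \beta'(G)-1.$$ Moreover, if $G$ is a tree, then equality $\dim_{\mathrm{n}\ell}(G)=\beta'(G)-1$ holds if and only if $G$ is obtained from a star $K_{1,m}$, $m\ge 1$, by subdividing all but one of its edges at most once; that is, some edge of the star is left unsubdivided, and each of the other edges is either left unsubdivided or subdivided exactly once. -/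

import Mathlib

namespace SimpleGraph

/-- `X` is a nonlocal resolving set of `G`: every two distinct non-adjacent vertices `u`, `v`
are resolved by some `x ∈ X`, that is, `d(u, x) ≠ d(v, x)`. -/
def IsNonlocalResolvingSet {V : Type*} (G : SimpleGraph V) (X : Finset V) : Prop :=
  ∀ u v : V, u ≠ v → ¬ G.Adj u v → ∃ x ∈ X, G.dist u x ≠ G.dist v x

/-- The nonlocal metric dimension: the least cardinality of a nonlocal resolving set. (In a finite
connected graph the set of all vertices is a nonlocal resolving set.) -/
noncomputable def nonlocalMetricDim {V : Type*} (G : SimpleGraph V) : ℕ :=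
  sInf {k : ℕ | ∃ X : Finset V, G.IsNonlocalResolvingSet X ∧ X.card = k}

/-- `S` is an edge cover of `G`: a set of edges such that each vertex is incident with
at least one of them. -/
def IsEdgeCoverSet {V : Type*} (G : SimpleGraph V) (S : Finset (Sym2 V)) : Prop :=
  (∀ e ∈ S, e ∈ G.edgeSet) ∧ ∀ v : V, ∃ e ∈ S, v ∈ e

/-- The edge cover number: the least cardinality of an edge cover. (A finite graph without
isolated vertices has an edge cover, namely the set of all its edges.) -/
noncomputable def edgeCoverNum {V : Type*} (G : SimpleGraph V) : ℕ :=
  sInf {k : ℕ | ∃ S : Finset (Sym2 V), G.IsEdgeCoverSet S ∧ S.card = k}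

/-- The graph obtained from `H` by subdividing exactly once each edge that belongs to `F` and
leaving all the other edges as they are. The vertices are those of `H`, together with one new
vertex for each `e ∈ F`, which is adjacent precisely to the two ends of `e`. -/
def subdivide {W : Type*} (H : SimpleGraph W) (F : Set (Sym2 W)) :
    SimpleGraph (W ⊕ {e : Sym2 W // e ∈ F ∧ e ∈ H.edgeSet}) where
  Adj
    | Sum.inl u, Sum.inl v => H.Adj u v ∧ s(u, v) ∉ F
    | Sum.inl u, Sum.inr e => u ∈ e.1
    | Sum.inr e, Sum.inl u => u ∈ e.1
    | Sum.inr _, Sum.inr _ => False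
  symm := ⟨by
    rintro (u | e) (v | f) h
    · exact ⟨h.1.symm, fun hF => h.2 (Sym2.eq_swap ▸ hF)⟩
    · exact h
    · exact h
    · exact h⟩
  loopless := ⟨by
    rintro (u | e) h
    · exact H.loopless.irrefl u h.1
    · exact h⟩

/-- `G` is obtained (up to isomorphism) from a star `K_{1,m}` by subdividing all but one of its edges at most
once: one edge `e₀` of the star is left as it is, and each of the others is
either left as it is or subdivided exactly once. -/
def IsStarSubdividedAllButOneAtMostOnce {V : Type*} (G : SimpleGraph V) : Prop :=
  ∃ (m : ℕ) (e₀ : Sym2 (Fin (m + 1))) (F : Set (Sym2 (Fin (m + 1)))),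
    e₀ ∈ (starGraph (0 : Fin (m + 1))).edgeSet ∧ F ⊆ (starGraph (0 : Fin (m + 1))).edgeSet \ {e₀} ∧
      Nonempty (G ≃g (starGraph (0 : Fin (m + 1))).subdivide F)

end SimpleGraph

namespace SimpleGraph

variable {V : Type*} {G : SimpleGraph V}

/-! A minimum edge cover is a disjoint union of stars, and its set `L` of leaves has as many
elements as the cover has edges. Two distinct centres are resolved by leaves attached to them, for
otherwise a quadrilateral closes. One element can be saved. If a star has two leaves, one of them
may be dropped, as a failure would close a hexagon (`isNonlocalResolvingSet_leaves_erase`). If all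
stars are single edges, one edge is skipped altogether and the representatives of the others are
chosen non-adjacent to it.

In a tree the end vertices without any one of them resolve everything. Apart from `K₂`, an edge
contains at most one end vertex, so equality forces a minimum cover to have exactly one edge per end
vertex; hence every vertex is an end vertex or next to one. Two major vertices would let a second
end vertex be dropped, so there is at most one, and the tree is a subdivided star. Conversely, a
resolving set must meet all but one of the `m` branches at the centre, while `m` edges suffice for a
cover. -/

/-! ### Short cycles excluded by the girth -/

lemma not_triangle_of_egirth (hg : 7 ≤ G.egirth) {a b c : V} (hab : G.Adj a b) (hbc : G.Adj b c)
    (hca : G.Adj c a) : False := by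
  have hc : (Walk.cons hab (Walk.cons hbc (Walk.cons hca Walk.nil))).IsCycle := by
    have h1 := hab.ne; have h2 := hbc.ne; have h3 := hca.ne
    simp [Walk.cons_isCycle_iff]
    grind
  have := le_egirth.mp hg _ _ hc
  simp at this
  norm_cast at this

lemma eq_of_common_neighbors (hg : 7 ≤ G.egirth) {a b x y : V} (hab : a ≠ b) (hax : G.Adj a x)
    (hxb : G.Adj x b) (hay : G.Adj a y) (hyb : G.Adj y b) : x = y := by
  by_contra hxy
  have hc : (Walk.cons hax (Walk.cons hxb (Walk.cons hyb.symm (Walk.cons hay.symm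
      Walk.nil)))).IsCycle := by
    have h1 := hax.ne; have h2 := hxb.ne; have h3 := hay.ne; have h4 := hyb.ne
    simp [Walk.cons_isCycle_iff]
    grind
  have := le_egirth.mp hg _ _ hc
  simp at this
  norm_cast at this

lemma not_hexagon_of_egirth (hg : 7 ≤ G.egirth) {a b c d e f : V} (hab : G.Adj a b)
    (hbc : G.Adj b c) (hcd : G.Adj c d) (hde : G.Adj d e) (hef : G.Adj e f) (hfa : G.Adj f a)
    (hn : [a, b, c, d, e, f].Nodup) : False := by
  have hc : (Walk.cons hab (Walk.cons hbc (Walk.cons hcd (Walk.cons hde (Walk.cons hef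
      (Walk.cons hfa Walk.nil)))))).IsCycle := by
    simp at hn
    simp [Walk.cons_isCycle_iff]
    grind
  have := le_egirth.mp hg _ _ hc
  simp at this
  norm_cast at this

/-! ### Minimum edge covers and minimum resolving sets -/

lemma nonlocalMetricDim_le {X : Finset V} (hX : G.IsNonlocalResolvingSet X) :
    G.nonlocalMetricDim ≤ X.card :=
  Nat.sInf_le ⟨X, hX, rfl⟩

lemma edgeCoverNum_le {S : Finset (Sym2 V)} (hS : G.IsEdgeCoverSet S) :
    G.edgeCoverNum ≤ S.card :=
  Nat.sInf_le ⟨S, hS, rfl⟩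

lemma Connected.exists_adj [Nontrivial V] (hG : G.Connected) (v : V) : ∃ w, G.Adj v w :=
  hG.preconnected.exists_adj_of_nontrivial v

lemma exists_isEdgeCoverSet_card_eq [Finite V] (hG : ∀ v, ∃ w, G.Adj v w) :
    ∃ S : Finset (Sym2 V), G.IsEdgeCoverSet S ∧ S.card = G.edgeCoverNum := by
  refine Nat.sInf_mem (s := {k | ∃ S : Finset (Sym2 V), G.IsEdgeCoverSet S ∧ S.card = k})
    ⟨_, (Set.toFinite G.edgeSet).toFinset, ⟨fun e he => by simpa using he, fun v => ?_⟩, rfl⟩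
  obtain ⟨w, hw⟩ := hG v
  exact ⟨s(v, w), by simpa using hw, by simp⟩

lemma exists_nonlocalResolvingSet_card_eq [Finite V] (hG : G.Connected) :
    ∃ X : Finset V, G.IsNonlocalResolvingSet X ∧ X.card = G.nonlocalMetricDim := by
  refine Nat.sInf_mem (s := {k | ∃ X : Finset V, G.IsNonlocalResolvingSet X ∧ X.card = k})
    ⟨_, (Set.toFinite Set.univ).toFinset, fun u v huv _ => ⟨u, by simp, ?_⟩, rfl⟩
  rw [dist_self]
  exact (hG.pos_dist_of_ne huv.symm).ne

/-- A minimum edge cover is a spanning forest of stars: `L` collects the leaves of the stars and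
`c` sends a leaf to the centre of its star. -/
lemma exists_spanning_star_forest [Finite V] [Nonempty V] (hG : ∀ v, ∃ w, G.Adj v w) :
    ∃ (L : Finset V) (c : V → V), L.card = G.edgeCoverNum ∧
      (∀ x ∈ L, c x ∉ L ∧ G.Adj x (c x)) ∧ ∀ v ∉ L, ∃ x ∈ L, c x = v := by
  classical
  obtain ⟨S, hS, hcard⟩ := exists_isEdgeCoverSet_card_eq hG
  -- By minimality each edge of `S` has a private end `p e`, covered by no other edge; otherwise the
  -- edge could be removed.
  have hpriv : ∀ e ∈ S, ∃ p q, e = s(p, q) ∧ ∀ f ∈ S, p ∈ f → f = e := by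
    intro e he
    by_contra hcon
    have hcov : G.IsEdgeCoverSet (S.erase e) := by
      refine ⟨fun f hf => hS.1 f (Finset.mem_of_mem_erase hf), fun v => ?_⟩
      obtain ⟨f, hf, hvf⟩ := hS.2 v
      by_cases hfe : f = e
      · subst hfe
        obtain ⟨w, rfl⟩ := Sym2.mem_iff_exists.mp hvf
        by_contra hno
        refine hcon ⟨v, w, rfl, fun g hg hvg => ?_⟩
        by_contra hne
        exact hno ⟨g, Finset.mem_erase.mpr ⟨hne, hg⟩, hvg⟩
      · exact ⟨f, Finset.mem_erase.mpr ⟨hfe, hf⟩, hvf⟩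
    have h1 := edgeCoverNum_le hcov
    have h2 := Finset.card_erase_lt_of_mem he
    omega
  choose! p q hpq hp using hpriv
  have hpe : ∀ e ∈ S, p e ∈ e := fun e he => Sym2.mem_iff_exists.mpr ⟨q e, hpq e he⟩
  have hqe : ∀ e ∈ S, q e ∈ e := fun e he =>
    Sym2.mem_iff_exists.mpr ⟨p e, (hpq e he).trans Sym2.eq_swap⟩
  have hinj : Set.InjOn p S := fun e he f hf hef => hp f hf e he (hef ▸ hpe e he)
  have hadj : ∀ e ∈ S, G.Adj (p e) (q e) := fun e he => by
    have := hS.1 e he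
    rwa [hpq e he, mem_edgeSet] at this
  choose! g hgS hg using hS.2
  have hgp : ∀ e ∈ S, g (p e) = e := fun e he => hp e he _ (hgS _) (hg _)
  -- The leaves are the private ends. The only edge of `S` at a leaf `x` is `g x`, whose other end
  -- is the centre.
  refine ⟨S.image p, fun x => q (g x), ?_, ?_, ?_⟩
  · rw [Finset.card_image_of_injOn hinj, hcard]
  · intro x hx
    obtain ⟨e, he, rfl⟩ := Finset.mem_image.mp hx
    simp only [hgp e he]
    refine ⟨fun hq => ?_, hadj e he⟩
    obtain ⟨f, hf, hfq⟩ := Finset.mem_image.mp hq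
    have hef : e = f := hp f hf e he (hfq ▸ hqe e he)
    subst hef
    exact (hadj e he).ne hfq
  · intro v hv
    have hvp : v ≠ p (g v) := fun h => hv (Finset.mem_image.mpr ⟨g v, hgS v, h.symm⟩)
    refine ⟨p (g v), Finset.mem_image_of_mem _ (hgS v), ?_⟩
    simp only [hgp _ (hgS v)]
    have := hg v
    rw [hpq _ (hgS v), Sym2.mem_iff] at this
    rcases this with h | h
    · exact absurd h hvp
    · exact h.symm

/-! ### The inequality -/

/-- Distinct vertices are resolved by any two distinct neighbours of theirs. -/
lemma dist_ne_of_adj_adj (hg : 7 ≤ G.egirth) {u v x y : V} (huv : u ≠ v)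
    (hux : G.Adj u x) (hvy : G.Adj v y) (hxy : x ≠ y) :
    G.dist u x ≠ G.dist v x ∨ G.dist u y ≠ G.dist v y := by
  by_contra! h
  rw [dist_eq_one_iff_adj.mpr hux, dist_eq_one_iff_adj.mpr hvy] at h
  exact hxy (eq_of_common_neighbors hg huv hux (dist_eq_one_iff_adj.mp h.1.symm).symm
    (dist_eq_one_iff_adj.mp h.2) hvy.symm)

lemma isNonlocalResolvingSet_of_forall_notMem {X : Finset V} (hG : G.Connected)
    (h : ∀ u v : V, u ≠ v → ¬ G.Adj u v → u ∉ X → v ∉ X → ∃ x ∈ X, G.dist u x ≠ G.dist v x) :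
    G.IsNonlocalResolvingSet X := by
  intro u v huv hn
  by_cases hu : u ∈ X
  · exact ⟨u, hu, by rw [dist_self]; exact (hG.pos_dist_of_ne huv.symm).ne⟩
  by_cases hv : v ∈ X
  · exact ⟨v, hv, by rw [dist_self]; exact (hG.pos_dist_of_ne huv).ne'⟩
  exact h u v huv hn hu hv

/-- If two leaves `y`, `z` of a spanning star forest share their centre, then all the leaves but
`z` form a nonlocal resolving set. -/
lemma isNonlocalResolvingSet_leaves_erase [DecidableEq V] (hG : G.Connected) (hg : 7 ≤ G.egirth)
    {L : Finset V} {c : V → V} (hL : ∀ x ∈ L, c x ∉ L ∧ G.Adj x (c x))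
    (hc : ∀ v ∉ L, ∃ x ∈ L, c x = v) {y z : V} (hy : y ∈ L) (hz : z ∈ L) (hyz : y ≠ z)
    (hcyz : c y = c z) : G.IsNonlocalResolvingSet (L.erase z) := by
  -- The common centre of `y` and `z` keeps the leaf `y`.
  have hcent : ∀ v ∉ L, ∃ x ∈ L.erase z, c x = v := by
    intro v hv
    obtain ⟨x, hx, rfl⟩ := hc v hv
    by_cases hxz : x = z
    · exact ⟨y, by simp [hy, hyz], by rw [hcyz, hxz]⟩
    · exact ⟨x, by simp [hx, hxz], rfl⟩
  have hcz := (hL z hz).2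
  have hcy : G.Adj y (c z) := hcyz ▸ (hL y hy).2
  have hdzy : G.dist z y = 2 := by
    have h1 := hG.one_lt_dist_of_ne_of_not_adj hyz.symm
      (fun h => not_triangle_of_egirth hg h hcy hcz.symm)
    have h2 := dist_le (Walk.cons hcz (Walk.cons hcy.symm Walk.nil))
    simp at h2
    omega
  -- If a centre `v = c x` and `z` are unresolved, then `x` gives `z ~ x`, and `y` gives `d(v, y) =
  -- 2` with a midpoint `w`. So `z, x, c x, w, y, c z` is a hexagon.
  have key : ∀ v ∉ L, ¬ G.Adj v z → ∃ x ∈ L.erase z, G.dist v x ≠ G.dist z x := by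
    intro v hv hvz
    by_contra! hcon
    obtain ⟨x, hx, rfl⟩ := hcent v hv
    obtain ⟨hxz, hxL⟩ := Finset.mem_erase.mp hx
    have hxv := (hL x hxL).2
    have hzx : G.Adj z x := by
      rw [← dist_eq_one_iff_adj, ← hcon x hx, dist_eq_one_iff_adj]
      exact hxv.symm
    have hvy : G.dist (c x) y = 2 := by rw [hcon y (by simp [hy, hyz]), hdzy]
    have hwalk : ∃ w, G.Adj (c x) w ∧ G.Adj w y := by
      obtain ⟨p, hp⟩ := hG.exists_walk_length_eq_dist (c x) y
      rw [hvy] at hp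
      match p, hp with
      | Walk.cons h (Walk.cons h' Walk.nil), _ => exact ⟨_, h, h'⟩
    obtain ⟨w, hvw, hwy⟩ := hwalk
    have hvc : c x ≠ c z := fun h => hvz (h ▸ hcz.symm)
    have hxc : x ≠ c z := fun h => (hL z hz).1 (h ▸ hxL)
    have hvz' : c x ≠ z := fun h => hv (h ▸ hz)
    have hvy' : c x ≠ y := fun h => hv (h ▸ hy)
    have hwz : w ≠ z := fun h => hvz (h ▸ hvw)
    have hwc : w ≠ c z := by
      rintro rfl
      exact hxc (eq_of_common_neighbors hg hvz' hxv.symm hzx.symm hvw hcz.symm)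
    have hwx : w ≠ x := by
      rintro rfl
      exact hxc (eq_of_common_neighbors hg hyz hwy.symm hzx.symm hcy hcz.symm)
    have hxy : x ≠ y := by
      rintro rfl
      exact not_triangle_of_egirth hg hzx hcy hcz.symm
    refine not_hexagon_of_egirth hg hzx hxv hvw hwy hcy hcz.symm ?_
    have := hcy.ne; have := hcz.ne; have := hxv.ne; have := hvw.ne; have := hwy.ne
    simp
    grind
  refine isNonlocalResolvingSet_of_forall_notMem hG fun u v huv hn hu hv => ?_
  by_cases huL : u ∈ L
  · have huz : u = z := by grind
    subst huz
    obtain ⟨x, hx, h⟩ := key v (by grind) (fun h => hn h.symm)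
    exact ⟨x, hx, h.symm⟩
  by_cases hvL : v ∈ L
  · have hvz : v = z := by grind
    subst hvz
    exact key u huL hn
  obtain ⟨x, hx, rfl⟩ := hcent u huL
  obtain ⟨y, hy, rfl⟩ := hcent v hvL
  rcases dist_ne_of_adj_adj hg huv (hL x (Finset.mem_of_mem_erase hx)).2.symm
    (hL y (Finset.mem_of_mem_erase hy)).2.symm (fun h => huv (by rw [h])) with h | h
  · exact ⟨x, hx, h⟩
  · exact ⟨y, hy, h⟩

/-- A spanning star forest all of whose stars are single edges `s(x, c x)`, `x ∈ L`. Choosing from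
each edge but `s(z, c z)` an end with no neighbour in `{z, c z}` gives a nonlocal resolving set. -/
lemma exists_isNonlocalResolvingSet_of_perfect_matching (hG : G.Connected) (hg : 7 ≤ G.egirth)
    {L : Finset V} {c : V → V} (hL : ∀ x ∈ L, c x ∉ L ∧ G.Adj x (c x))
    (hc : ∀ v ∉ L, ∃ x ∈ L, c x = v) (hinj : Set.InjOn c L) {z : V} (hz : z ∈ L) :
    ∃ X : Finset V, G.IsNonlocalResolvingSet X ∧ X.card ≤ L.card - 1 := by
  classical
  have hcz := (hL z hz).2
  have hchoice : ∀ x ∈ L.erase z, ∃ r t, ((r = x ∧ t = c x) ∨ (r = c x ∧ t = x)) ∧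
      ¬ G.Adj r z ∧ ¬ G.Adj r (c z) := by
    intro x hx
    obtain ⟨hxz, hxL⟩ := Finset.mem_erase.mp hx
    have hxc := (hL x hxL).2
    have hne : c x ≠ c z := fun h => hxz (hinj hxL hz h)
    have h1 : x ≠ c z := fun h => (hL z hz).1 (h ▸ hxL)
    have h2 : c x ≠ z := fun h => (hL x hxL).1 (h ▸ hz)
    -- Otherwise both ends of the edge `s(x, c x)` are adjacent to the edge `s(z, c z)`, which
    -- closes a triangle or a quadrilateral.
    by_contra! hcon
    have ha := hcon x (c x) (Or.inl ⟨rfl, rfl⟩)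
    have hb := hcon (c x) x (Or.inr ⟨rfl, rfl⟩)
    by_cases hxz' : G.Adj x z
    · by_cases hcxz : G.Adj (c x) z
      · exact not_triangle_of_egirth hg hxc hcxz hxz'.symm
      · exact h2 (eq_of_common_neighbors hg h1 hxc (hb hcxz) hxz' hcz)
    · by_cases hcxz : G.Adj (c x) z
      · exact hne (eq_of_common_neighbors hg hxz hxc hcxz (ha hxz') hcz.symm)
      · exact not_triangle_of_egirth hg hxc (hb hcxz) (ha hxz').symm
  choose! r t hrt hrz hrc using hchoice
  have hadj : ∀ x ∈ L.erase z, G.Adj (t x) (r x) := by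
    intro x hx
    have hxc := (hL x (Finset.mem_of_mem_erase hx)).2
    rcases hrt x hx with ⟨h1, h2⟩ | ⟨h1, h2⟩ <;> rw [h1, h2]
    · exact hxc.symm
    · exact hxc
  have hrinj : ∀ x ∈ L.erase z, ∀ y ∈ L.erase z, r x = r y → x = y := by
    intro x hx y hy hxy
    have hxL := Finset.mem_of_mem_erase hx
    have hyL := Finset.mem_of_mem_erase hy
    rcases hrt x hx with ⟨h1, -⟩ | ⟨h1, -⟩ <;> rcases hrt y hy with ⟨h2, -⟩ | ⟨h2, -⟩ <;>
      rw [h1, h2] at hxy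
    · exact hxy
    · exact absurd (hxy ▸ hxL) (hL y hyL).1
    · exact absurd (hxy ▸ hyL) (hL x hxL).1
    · exact hinj hxL hyL hxy
  have hcover : ∀ v ∉ (L.erase z).image r, v = z ∨ v = c z ∨ ∃ x ∈ L.erase z, t x = v := by
    intro v hv
    have hex : ∃ x ∈ L, v = x ∨ v = c x := by
      by_cases hvL : v ∈ L
      · exact ⟨v, hvL, Or.inl rfl⟩
      · obtain ⟨x, hx, rfl⟩ := hc v hvL
        exact ⟨x, hx, Or.inr rfl⟩
    obtain ⟨x, hx, hvx⟩ := hex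
    by_cases hxz : x = z
    · subst hxz; tauto
    · have hxe : x ∈ L.erase z := by simp [hx, hxz]
      have : v ≠ r x := fun h => hv (h ▸ Finset.mem_image_of_mem r hxe)
      rcases hrt x hxe with ⟨h1, h2⟩ | ⟨h1, h2⟩ <;> grind
  -- The representative `r x` is at distance 1 from its partner `t x` but not from `z` or `c z`.
  have hone : ∀ u, (u = z ∨ u = c z) → ∀ x ∈ L.erase z,
      G.dist u (r x) ≠ G.dist (t x) (r x) := by
    intro u hu x hx
    rw [dist_eq_one_iff_adj.mpr (hadj x hx), Ne, dist_eq_one_iff_adj]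
    rcases hu with rfl | rfl
    · exact fun h => hrz x hx h.symm
    · exact fun h => hrc x hx h.symm
  refine ⟨(L.erase z).image r, isNonlocalResolvingSet_of_forall_notMem hG
    fun u v huv hn hu hv => ?_, ?_⟩
  · rcases or_assoc.mpr (hcover u hu) with hu' | ⟨x, hx, rfl⟩ <;>
      rcases or_assoc.mpr (hcover v hv) with hv' | ⟨y, hy, rfl⟩
    · rcases hu' with rfl | rfl <;> rcases hv' with rfl | rfl
      · exact absurd rfl huv
      · exact absurd hcz hn
      · exact absurd hcz.symm hn
      · exact absurd rfl huv
    · exact ⟨r y, Finset.mem_image_of_mem r hy, hone u hu' y hy⟩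
    · exact ⟨r x, Finset.mem_image_of_mem r hx, (hone v hv' x hx).symm⟩
    · rcases dist_ne_of_adj_adj hg huv (hadj x hx) (hadj y hy)
        (fun h => huv (by rw [hrinj x hx y hy h])) with h | h
      · exact ⟨r x, Finset.mem_image_of_mem r hx, h⟩
      · exact ⟨r y, Finset.mem_image_of_mem r hy, h⟩
  · exact Finset.card_image_le.trans (Finset.card_erase_of_mem hz).le

theorem nonlocalMetricDim_add_one_le_edgeCoverNum [Finite V] [Nontrivial V] (hG : G.Connected)
    (hg : 7 ≤ G.egirth) : G.nonlocalMetricDim + 1 ≤ G.edgeCoverNum := by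
  classical
  obtain ⟨L, c, hcard, hL, hc⟩ := exists_spanning_star_forest hG.exists_adj
  have hne : L.Nonempty := by
    obtain ⟨v⟩ := hG.nonempty
    by_cases hv : v ∈ L
    · exact ⟨v, hv⟩
    · obtain ⟨x, hx, -⟩ := hc v hv
      exact ⟨x, hx⟩
  have hpos := hne.card_pos
  obtain ⟨X, hX, hXL⟩ : ∃ X : Finset V, G.IsNonlocalResolvingSet X ∧ X.card ≤ L.card - 1 := by
    by_cases hinj : Set.InjOn c L
    · exact exists_isNonlocalResolvingSet_of_perfect_matching hG hg hL hc hinj hne.choose_spec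
    · simp only [Set.InjOn] at hinj
      push Not at hinj
      obtain ⟨y, hy, z, hz, hcyz, hyz⟩ := hinj
      exact ⟨L.erase z, isNonlocalResolvingSet_leaves_erase hG hg hL hc hy hz hyz hcyz,
        (Finset.card_erase_of_mem hz).le⟩
  have := nonlocalMetricDim_le hX
  omega

/-! ### Resolving trees by end vertices -/

/-- A vertex with at most one neighbour. -/
def IsEndVertex (G : SimpleGraph V) (x : V) : Prop :=
  ∃ a, ∀ y, G.Adj x y → y = a

/-- A vertex with at least three neighbours. -/
def IsMajorVertex (G : SimpleGraph V) (x : V) : Prop :=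
  ∀ a b, ∃ y, G.Adj x y ∧ y ≠ a ∧ y ≠ b

lemma IsEndVertex.eq_of_adj {x a b : V} (hx : G.IsEndVertex x) (ha : G.Adj x a)
    (hb : G.Adj x b) : a = b := by
  obtain ⟨d, hd⟩ := hx
  rw [hd a ha, hd b hb]

lemma IsEndVertex.dist_eq_add_one (hG : G.Connected) {s z w : V} (hz : G.IsEndVertex z)
    (hsz : G.Adj s z) (hw : w ≠ z) : G.dist w z = G.dist w s + 1 := by
  have h1 := hG.dist_triangle (u := w) (v := s) (w := z)
  rw [dist_eq_one_iff_adj.mpr hsz] at h1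
  refine le_antisymm h1 ?_
  rw [dist_comm, dist_comm (u := w)]
  obtain ⟨p, hp⟩ := hG.exists_walk_length_eq_dist z w
  rw [← hp]
  cases p with
  | nil => exact absurd rfl hw
  | cons h p =>
    obtain rfl := hz.eq_of_adj hsz.symm h
    simpa using dist_le p

lemma IsMajorVertex.not_isEndVertex {x : V} (hx : G.IsMajorVertex x) : ¬ G.IsEndVertex x := by
  rintro ⟨a, ha⟩
  obtain ⟨y, hy, hya, -⟩ := hx a a
  exact hya (ha y hy)

/-- Geodesics from `v` through `a` and through `b` are both the unique path from `v` to `x`. -/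
lemma IsTree.eq_of_adj_of_dist_eq_add_one (hG : G.IsTree) {v x a b : V} (hxa : G.Adj x a)
    (hxb : G.Adj x b) (ha : G.dist v x = G.dist v a + 1) (hb : G.dist v x = G.dist v b + 1) :
    a = b := by
  obtain ⟨p, hp⟩ := hG.connected.exists_walk_length_eq_dist v a
  obtain ⟨q, hq⟩ := hG.connected.exists_walk_length_eq_dist v b
  have hp' := Walk.isPath_of_length_eq_dist (p.concat hxa.symm) (by simp [hp, ha])
  have hq' := Walk.isPath_of_length_eq_dist (q.concat hxb.symm) (by simp [hq, hb])
  exact (Walk.concat_inj ((hG.existsUnique_path v x).unique hp' hq')).1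

/-- In a tree all the neighbours of `x` but at most one are farther from `v` than `x`. -/
lemma IsTree.exists_parent (hG : G.IsTree) (v x : V) :
    ∃ p, ∀ y, G.Adj x y → y ≠ p → G.dist v y = G.dist v x + 1 := by
  by_cases h : ∃ p, G.Adj x p ∧ G.dist v x = G.dist v p + 1
  · obtain ⟨p, hp, hpd⟩ := h
    refine ⟨p, fun y hy hyp => ?_⟩
    rcases hG.dist_eq_dist_add_one_of_adj v hy with h | h
    · exact absurd (hG.eq_of_adj_of_dist_eq_add_one hy hp h hpd) hyp
    · exact h
  · refine ⟨v, fun y hy _ => ?_⟩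
    rcases hG.dist_eq_dist_add_one_of_adj v hy with h' | h'
    · exact absurd ⟨y, hy, h'⟩ h
    · exact h'

/-- In a finite tree there is an end vertex behind `u` when seen from `v`. -/
lemma IsTree.exists_isEndVertex_dist_eq [Finite V] (hG : G.IsTree) (v u : V) :
    ∃ x, G.IsEndVertex x ∧ G.dist v x = G.dist v u + G.dist u x := by
  -- Among the vertices behind `u`, one farthest from `v` has no neighbour besides its parent.
  obtain ⟨x, hx, hmax⟩ := Set.exists_max_image {x | G.dist v x = G.dist v u + G.dist u x}
    (fun x => G.dist v x) (Set.toFinite _) ⟨u, by simp⟩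
  refine ⟨x, ?_, hx⟩
  obtain ⟨p, hp⟩ := hG.exists_parent v x
  refine ⟨p, fun y hy => ?_⟩
  by_contra hyp
  have h1 := hp y hy hyp
  have h2 := hG.connected.dist_triangle (u := v) (v := u) (w := y)
  have h3 := hG.connected.dist_triangle (u := u) (v := x) (w := y)
  rw [dist_eq_one_iff_adj.mpr hy] at h3
  have hx' : G.dist v x = G.dist v u + G.dist u x := hx
  have := hmax y (show G.dist v y = _ by omega)
  lia

/-- In a tree, the end vertices except any one of them form a resolving set. -/
lemma IsTree.isNonlocalResolvingSet_erase [Finite V] [DecidableEq V] (hG : G.IsTree)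
    {L : Finset V} (hL : ∀ x, x ∈ L ↔ G.IsEndVertex x) (z : V) :
    G.IsNonlocalResolvingSet (L.erase z) := by
  intro u v huv _
  have hpos := hG.connected.pos_dist_of_ne huv
  have hcomm : G.dist v u = G.dist u v := dist_comm
  -- End vertices behind `u` and behind `v` both resolve the pair and are distinct, so one of them
  -- is not `z`.
  obtain ⟨x, hx, hxd⟩ := hG.exists_isEndVertex_dist_eq v u
  obtain ⟨y, hy, hyd⟩ := hG.exists_isEndVertex_dist_eq u v
  by_cases hxz : x = z
  · refine ⟨y, Finset.mem_erase.mpr ⟨?_, (hL y).mpr hy⟩, by omega⟩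
    rintro rfl
    subst hxz
    omega
  · exact ⟨x, Finset.mem_erase.mpr ⟨hxz, (hL x).mpr hx⟩, by omega⟩

/-- Seen from any vertex, behind a major vertex there are end vertices other than a given
neighbour. -/
lemma IsTree.exists_isEndVertex_ne [Finite V] (hG : G.IsTree) {s z : V}
    (hs : G.IsMajorVertex s) (hsz : G.Adj s z) (v : V) :
    ∃ x, G.IsEndVertex x ∧ x ≠ z ∧ G.dist v x = G.dist v s + G.dist s x := by
  obtain ⟨p, hp⟩ := hG.exists_parent v s
  obtain ⟨a, ha, hap, haz⟩ := hs p z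
  obtain ⟨x, hx, hxd⟩ := hG.exists_isEndVertex_dist_eq v a
  have h1 := hp a ha hap
  have h2 := hG.connected.dist_triangle (u := v) (v := s) (w := x)
  have h3 := hG.connected.dist_triangle (u := s) (v := a) (w := x)
  rw [dist_eq_one_iff_adj.mpr ha] at h3
  refine ⟨x, hx, ?_, by omega⟩
  rintro rfl
  have h4 : G.dist s x = 1 := dist_eq_one_iff_adj.mpr hsz
  have h5 := hG.connected.pos_dist_of_ne haz
  omega

/-- In a tree, one end vertex at each of two major vertices can be spared from the set of end
vertices, which remains resolving. -/
lemma IsTree.isNonlocalResolvingSet_erase_erase [Finite V] [DecidableEq V] (hG : G.IsTree)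
    {L : Finset V} (hL : ∀ x, x ∈ L ↔ G.IsEndVertex x) {s₁ s₂ z₁ z₂ : V}
    (hs₁ : G.IsMajorVertex s₁) (hs₂ : G.IsMajorVertex s₂) (hs : s₁ ≠ s₂) (hz₁ : G.Adj s₁ z₁)
    (hz₂ : G.Adj s₂ z₂) (he₁ : G.IsEndVertex z₁) (he₂ : G.IsEndVertex z₂) :
    G.IsNonlocalResolvingSet ((L.erase z₁).erase z₂) := by
  intro u v huv _
  by_contra! hcon
  have hmem : ∀ x, G.IsEndVertex x → G.dist u x ≠ G.dist v x → x = z₁ ∨ x = z₂ := by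
    intro x hx hne
    by_contra! h
    exact hne (hcon x (by simp [h, (hL x).mpr hx]))
  -- If `z` is the only end vertex behind `u` when seen from `v`, then `u = z`.
  have key : ∀ {u v s z z' : V}, u ≠ v →
      (∀ x, G.IsEndVertex x → G.dist u x ≠ G.dist v x → x = z ∨ x = z') →
      G.IsMajorVertex s → G.Adj s z → G.IsEndVertex z →
      G.dist v z = G.dist v u + G.dist u z → G.dist u z' = G.dist u v + G.dist v z' → u = z := by
    intro u v s z z' huv hmem hs hsz he hz hz'
    by_contra hne
    have hpos := hG.connected.pos_dist_of_ne huv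
    have hcomm : G.dist v u = G.dist u v := dist_comm
    -- As `z` hangs at `s`, the vertex `s` is behind `u` too, and so is a further end vertex beyond
    -- `s`. It resolves the pair, and it is not `z'`, which lies behind `v`.
    have hbehind : G.dist v s = G.dist v u + G.dist u s := by
      have hvz : v ≠ z := by
        rintro rfl
        rw [dist_self] at hz
        omega
      rw [he.dist_eq_add_one hG.connected hsz hvz, he.dist_eq_add_one hG.connected hsz hne] at hz
      omega
    obtain ⟨x, hx, hxz, hxd⟩ := hG.exists_isEndVertex_ne hs hsz v
    have h1 := hG.connected.dist_triangle (u := v) (v := u) (w := x)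
    have h2 := hG.connected.dist_triangle (u := u) (v := s) (w := x)
    have h3 : G.dist v x = G.dist v u + G.dist u x := by omega
    rcases hmem x hx (by omega) with h | h
    · exact hxz h
    · subst h; omega
  -- This `x` resolves `z₁` and `z₂`: it is behind `s₁` as seen from `z₂`, and `d(z₂, s₁) ≥ 2` while
  -- `d(z₁, s₁) = 1`.
  obtain ⟨x, hx, hxz, hxd⟩ := hG.exists_isEndVertex_ne hs₁ hz₁ z₂
  have hs₁z₂ : s₁ ≠ z₂ := fun h => hs₁.not_isEndVertex (h ▸ he₂)
  have hd : G.dist z₁ x ≠ G.dist z₂ x := by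
    have h1 := he₂.dist_eq_add_one hG.connected hz₂ hs₁z₂
    have h2 := hG.connected.pos_dist_of_ne hs
    have h3 := hG.connected.dist_triangle (u := z₁) (v := s₁) (w := x)
    rw [dist_eq_one_iff_adj.mpr hz₁.symm] at h3
    rw [dist_comm] at h1
    omega
  have hxz₂ : x ≠ z₂ := by
    rintro rfl
    have := hG.connected.pos_dist_of_ne hs₁z₂
    rw [dist_self] at hxd
    omega
  have hpos := hG.connected.pos_dist_of_ne huv
  have hcomm : G.dist v u = G.dist u v := dist_comm
  obtain ⟨a, ha, had⟩ := hG.exists_isEndVertex_dist_eq v u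
  obtain ⟨b, hb, hbd⟩ := hG.exists_isEndVertex_dist_eq u v
  have hmem' : ∀ x, G.IsEndVertex x → G.dist v x ≠ G.dist u x → x = z₁ ∨ x = z₂ :=
    fun x hx h => hmem x hx h.symm
  have hab : a ≠ b := by
    rintro rfl
    omega
  -- The end vertices behind `u` and `v` are `z₁` and `z₂` in some order; by `key` they are `u` and
  -- `v` themselves, which `x` resolves.
  rcases hmem a ha (by omega) with rfl | rfl <;> rcases hmem b hb (by omega) with rfl | rfl
  · exact hab rfl
  · obtain rfl := key huv hmem hs₁ hz₁ he₁ had hbd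
    obtain rfl := key huv.symm (fun x hx h => (hmem' x hx h).symm) hs₂ hz₂ he₂ hbd had
    exact (hmem x hx hd).elim hxz hxz₂
  · obtain rfl := key huv (fun x hx h => (hmem x hx h).symm) hs₂ hz₂ he₂ had hbd
    obtain rfl := key huv.symm hmem' hs₁ hz₁ he₁ hbd had
    exact (hmem' x hx hd).elim hxz hxz₂
  · exact hab rfl

/-- From each `x ∈ X` all neighbours of `c` but one, `f x`, are at distance `d(x, c) + 1`. Two
neighbours outside the image of `f` would be non-adjacent and unresolved. -/
lemma IsTree.isNonlocalResolvingSet_card_ge (hG : G.IsTree) {X : Finset V}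
    (hX : G.IsNonlocalResolvingSet X) {c : V} {N : Finset V} (hN : ∀ y ∈ N, G.Adj c y) :
    N.card ≤ X.card + 1 := by
  classical
  choose f hf using fun x => hG.exists_parent x c
  have h1 : (N \ X.image f).card ≤ 1 := by
    rw [Finset.card_le_one]
    intro a ha b hb
    rw [Finset.mem_sdiff] at ha hb
    by_contra hab
    have hca := hN a ha.1
    have hcb := hN b hb.1
    have hnadj : ¬ G.Adj a b := by
      intro hadj
      refine hG.dist_ne_of_adj c hadj ?_
      rw [dist_eq_one_iff_adj.mpr hca, dist_eq_one_iff_adj.mpr hcb]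
    obtain ⟨x, hx, hne⟩ := hX a b hab hnadj
    have h := fun y (hy : y ∉ X.image f) (hcy : G.Adj c y) =>
      hf x y hcy (fun h => hy (h ▸ Finset.mem_image_of_mem f hx))
    apply hne
    rw [dist_comm, h a ha.2 hca, dist_comm (u := b), h b hb.2 hcb]
  have h2 := Finset.le_card_sdiff (X.image f) N
  have h3 : (X.image f).card ≤ X.card := Finset.card_image_le
  omega

/-! ### Structure of the extremal trees -/

lemma Connected.forall_of_adj (hG : G.Connected) {P : V → Prop} {x : V} (hx : P x)
    (h : ∀ a b, P a → G.Adj a b → P b) (v : V) : P v := by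
  obtain ⟨p⟩ := hG.preconnected x v
  induction p with
  | nil => exact hx
  | cons hadj _ ih => exact ih (h _ _ hx hadj)

/-- If no two end vertices are adjacent, then an edge cover has at least as many edges as there
are end vertices; if it has no more, then each vertex is an end vertex or adjacent to one. -/
lemma IsEdgeCoverSet.card_isEndVertex_le {S : Finset (Sym2 V)} {L : Finset V}
    (hS : G.IsEdgeCoverSet S) (hL : ∀ x, x ∈ L ↔ G.IsEndVertex x)
    (hadj : ∀ x y, G.IsEndVertex x → G.IsEndVertex y → ¬ G.Adj x y) :
    L.card ≤ S.card ∧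
      (S.card ≤ L.card → ∀ v, G.IsEndVertex v ∨ ∃ x, G.IsEndVertex x ∧ G.Adj v x) := by
  classical
  choose g hgS hg using hS.2
  -- Two end vertices covered by the same edge would be adjacent.
  have hinj : Set.InjOn g L := by
    intro x hx y hy hxy
    by_contra hne
    have hy' : y ∈ g x := hxy ▸ hg y
    have he := hS.1 _ (hgS x)
    rw [(Sym2.mem_and_mem_iff hne).mp ⟨hg x, hy'⟩, mem_edgeSet] at he
    exact hadj x y ((hL x).mp hx) ((hL y).mp hy) he
  have hsub : L.image g ⊆ S := Finset.image_subset_iff.mpr fun x _ => hgS x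
  have hcard : (L.image g).card = L.card := Finset.card_image_of_injOn hinj
  refine ⟨hcard ▸ Finset.card_le_card hsub, fun hle v => ?_⟩
  have heq := Finset.eq_of_subset_of_card_le hsub (hcard ▸ hle)
  have hv := hgS v
  rw [← heq, Finset.mem_image] at hv
  obtain ⟨x, hx, hxv⟩ := hv
  have hx' := (hL x).mp hx
  by_cases hvx : v = x
  · exact Or.inl (hvx ▸ hx')
  · have hvg : v ∈ g x := hxv ▸ hg v
    have he := hS.1 _ (hgS x)
    rw [(Sym2.mem_and_mem_iff hvx).mp ⟨hvg, hg x⟩, mem_edgeSet] at he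
    exact Or.inr ⟨x, hx', he⟩

/-- Dropping one end vertex gives `S.card ≤ L.card` for a minimum cover `S`, the equality case of
`IsEdgeCoverSet.card_isEndVertex_le`. Two major vertices would allow dropping two, which is one too
many. Adjacent end vertices occur only in `K₂`. -/
lemma IsTree.structure_of_nonlocalMetricDim_add_one_eq [Finite V] [Nontrivial V] (hG : G.IsTree)
    (h : G.nonlocalMetricDim + 1 = G.edgeCoverNum) :
    (∀ v, G.IsEndVertex v ∨ ∃ x, G.IsEndVertex x ∧ G.Adj v x) ∧
      ∀ s₁ s₂, G.IsMajorVertex s₁ → G.IsMajorVertex s₂ → s₁ = s₂ := by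
  classical
  have hconn := hG.connected
  by_cases hadj : ∀ x y, G.IsEndVertex x → G.IsEndVertex y → ¬ G.Adj x y
  · have : Fintype V := Fintype.ofFinite V
    obtain ⟨L, hL⟩ : ∃ L : Finset V, ∀ x, x ∈ L ↔ G.IsEndVertex x :=
      ⟨Finset.univ.filter G.IsEndVertex, by simp⟩
    obtain ⟨S, hS, hScard⟩ := exists_isEdgeCoverSet_card_eq hconn.exists_adj
    obtain ⟨hle, hstr⟩ := hS.card_isEndVertex_le hL hadj
    obtain ⟨v⟩ := hconn.nonempty
    obtain ⟨z, hz, -⟩ := hG.exists_isEndVertex_dist_eq v v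
    have h1 := nonlocalMetricDim_le (hG.isNonlocalResolvingSet_erase hL z)
    have h2 := Finset.card_erase_add_one ((hL z).mpr hz)
    have hstr' := hstr (by omega)
    refine ⟨hstr', fun s₁ s₂ hs₁ hs₂ => ?_⟩
    by_contra hs
    obtain ⟨z₁, he₁, hz₁⟩ := (hstr' s₁).resolve_left hs₁.not_isEndVertex
    obtain ⟨z₂, he₂, hz₂⟩ := (hstr' s₂).resolve_left hs₂.not_isEndVertex
    have hne : z₂ ≠ z₁ := by
      rintro rfl
      exact hs (he₁.eq_of_adj hz₁.symm hz₂.symm)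
    have h3 := nonlocalMetricDim_le
      (hG.isNonlocalResolvingSet_erase_erase hL hs₁ hs₂ hs hz₁ hz₂ he₁ he₂)
    have h4 := Finset.card_erase_add_one ((hL z₁).mpr he₁)
    have h5 := Finset.card_erase_add_one
      (Finset.mem_erase.mpr ⟨hne, (hL z₂).mpr he₂⟩)
    omega
  · push Not at hadj
    obtain ⟨x, y, hx, hy, hxy⟩ := hadj
    have hend : ∀ v, G.IsEndVertex v := fun v => by
      have : v = x ∨ v = y := by
        refine hconn.forall_of_adj (P := fun v => v = x ∨ v = y) (Or.inl rfl) ?_ v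
        rintro a b (rfl | rfl) hab
        · exact Or.inr (hx.eq_of_adj hab hxy)
        · exact Or.inl (hy.eq_of_adj hab hxy.symm)
      rcases this with rfl | rfl
      · exact hx
      · exact hy
    exact ⟨fun v => Or.inl (hend v), fun s₁ _ hs₁ _ => absurd (hend s₁) hs₁.not_isEndVertex⟩

/-- The local description of a star with centre `c`, some of whose edges are subdivided once. -/
lemma Connected.exists_centre [Nontrivial V] (hG : G.Connected)
    (hstr : ∀ v, G.IsEndVertex v ∨ ∃ x, G.IsEndVertex x ∧ G.Adj v x)
    (hmaj : ∀ s₁ s₂, G.IsMajorVertex s₁ → G.IsMajorVertex s₂ → s₁ = s₂) :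
    ∃ c, (∃ x, G.Adj c x ∧ G.IsEndVertex x) ∧ ∀ v, G.Adj c v → G.IsEndVertex v ∨
      ∃ b, b ≠ c ∧ G.Adj v b ∧ G.IsEndVertex b ∧ ∀ y, G.Adj v y → y = c ∨ y = b := by
  -- The centre is the major vertex if there is one; otherwise any vertex next to an end vertex
  -- serves.
  obtain ⟨c, ⟨x, hcx, hx⟩, hc⟩ : ∃ c, (∃ x, G.Adj c x ∧ G.IsEndVertex x) ∧
      ∀ v, v ≠ c → ¬ G.IsMajorVertex v := by
    by_cases h : ∃ c, G.IsMajorVertex c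
    · obtain ⟨c, hc⟩ := h
      obtain ⟨x, hx, hcx⟩ := (hstr c).resolve_left hc.not_isEndVertex
      exact ⟨c, ⟨x, hcx, hx⟩, fun v hv hm => hv (hmaj v c hm hc)⟩
    · push Not at h
      obtain ⟨v⟩ := hG.nonempty
      rcases hstr v with hv | ⟨x, hx, hvx⟩
      · obtain ⟨c, hc⟩ := hG.exists_adj v
        exact ⟨c, ⟨v, hc.symm, hv⟩, fun v _ => h v⟩
      · exact ⟨v, ⟨x, hvx, hx⟩, fun v _ => h v⟩
  refine ⟨c, ⟨x, hcx, hx⟩, fun v hcv => ?_⟩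
  rcases hstr v with hv | ⟨b, hb, hvb⟩
  · exact Or.inl hv
  by_cases hv : G.IsEndVertex v
  · exact Or.inl hv
  have hbc : b ≠ c := by
    rintro rfl
    exact hv (hb.eq_of_adj hcx hcv ▸ hx)
  refine Or.inr ⟨b, hbc, hvb, hb, fun y hy => ?_⟩
  have hnm := hc v hcv.ne'
  simp only [IsMajorVertex] at hnm
  push Not at hnm
  obtain ⟨p, q, hpq⟩ := hnm
  have h1 := hpq y hy
  have h2 := hpq b hvb
  have h3 := hpq c hcv.symm
  clear hpq hstr hmaj hc
  by_cases hyp : y = p <;> by_cases hbp : b = p <;> by_cases hcp : c = p <;> simp_all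

/-! ### The isomorphism with a subdivided star -/

/-- A graph with the local description of a subdivided star is isomorphic to one. -/
lemma Connected.isStarSubdividedAllButOneAtMostOnce [Finite V] (hG : G.Connected) {c x₀ : V}
    (hcx₀ : G.Adj c x₀) (hx₀ : G.IsEndVertex x₀)
    (hc : ∀ v, G.Adj c v → G.IsEndVertex v ∨
      ∃ b, b ≠ c ∧ G.Adj v b ∧ G.IsEndVertex b ∧ ∀ y, G.Adj v y → y = c ∨ y = b) :
    G.IsStarSubdividedAllButOneAtMostOnce := by
  classical
  -- `T v` is the end vertex of the branch at `c` that contains the neighbour `v` of `c`.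
  have hT : ∀ v, ∃ t, G.Adj c v → (t = v ∧ G.IsEndVertex v) ∨
      (t ≠ v ∧ t ≠ c ∧ G.Adj v t ∧ G.IsEndVertex t ∧ ∀ y, G.Adj v y → y = c ∨ y = t) := by
    intro v
    by_cases hv : G.Adj c v
    · rcases hc v hv with h | ⟨b, hbc, hvb, hb, h⟩
      · exact ⟨v, fun _ => Or.inl ⟨rfl, h⟩⟩
      · exact ⟨b, fun _ => Or.inr ⟨hvb.ne', hbc, hvb, hb, h⟩⟩
    · exact ⟨v, fun h => absurd h hv⟩
  choose T hT using hT
  have hTend : ∀ v, G.Adj c v → G.IsEndVertex (T v) := by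
    intro v hv
    rcases hT v hv with ⟨h, h'⟩ | ⟨-, -, -, h, -⟩
    · rwa [h]
    · exact h
  have hTc : ∀ v, G.Adj c v → T v ≠ c := by
    intro v hv
    rcases hT v hv with ⟨h, -⟩ | ⟨-, h, -⟩
    · rw [h]; exact hv.ne'
    · exact h
  have hTnbr : ∀ a b, G.Adj c a → G.Adj c b → T a = b → a = b := by
    intro a b ha hb hab
    rcases hT a ha with ⟨h, -⟩ | ⟨-, -, h, h', -⟩
    · rw [← h, hab]
    · rw [hab] at h h'
      exact absurd (h'.eq_of_adj hb.symm h.symm) ha.ne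
  have hTinj : ∀ a b, G.Adj c a → G.Adj c b → T a = T b → a = b := by
    intro a b ha hb hab
    rcases hT b hb with ⟨h, -⟩ | ⟨-, -, h, h', -⟩
    · exact hTnbr a b ha hb (hab.trans h)
    · rcases hT a ha with ⟨k, -⟩ | ⟨-, -, k, -⟩
      · exact (hTnbr b a hb ha (hab.symm.trans k)).symm
      · rw [hab] at k
        exact h'.eq_of_adj k.symm h.symm
  have hTx₀ : T x₀ = x₀ := by
    rcases hT x₀ hcx₀ with ⟨h, -⟩ | ⟨-, h, h', -⟩
    · exact h
    · exact absurd (hx₀.eq_of_adj h' hcx₀.symm) h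
  have hcover : ∀ v, v = c ∨ ∃ a, G.Adj c a ∧ (v = a ∨ v = T a) := by
    refine hG.forall_of_adj (x := c) (Or.inl rfl) ?_
    rintro p q (rfl | ⟨a, ha, rfl | rfl⟩) hpq
    · exact Or.inr ⟨q, hpq, Or.inl rfl⟩
    · rcases hT p ha with ⟨-, h⟩ | ⟨-, -, -, -, h⟩
      · exact Or.inl (h.eq_of_adj hpq ha.symm)
      · exact (h q hpq).imp id fun h => ⟨p, ha, Or.inr h⟩
    · rcases hT a ha with ⟨h, h'⟩ | ⟨-, -, h, h', -⟩
      · rw [h] at hpq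
        exact Or.inl (h'.eq_of_adj hpq ha.symm)
      · exact Or.inr ⟨a, ha, Or.inl (h'.eq_of_adj hpq h.symm)⟩
  obtain ⟨m, ⟨e⟩⟩ := Finite.exists_equiv_fin {v // G.Adj c v}
  let n : Fin m → V := fun i => (e.symm i).1
  have hn : ∀ i, G.Adj c (n i) := fun i => (e.symm i).2
  have hninj : ∀ i j, n i = n j → i = j := fun i j h => e.symm.injective (Subtype.ext h)
  have hnsurj : ∀ v, G.Adj c v → ∃ i, n i = v := fun v hv => ⟨e ⟨v, hv⟩, by simp [n]⟩
  obtain ⟨i₀, hi₀⟩ := hnsurj x₀ hcx₀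
  -- The subdivided edges correspond to the branches of length two.
  let F : Set (Sym2 (Fin (m + 1))) := {f | ∃ i : Fin m, f = s(0, i.succ) ∧ T (n i) ≠ n i}
  have hF : ∀ i : Fin m, s(0, i.succ) ∈ F ↔ T (n i) ≠ n i := by
    intro i
    refine ⟨fun ⟨j, hj, h⟩ => ?_, fun h => ⟨i, rfl, h⟩⟩
    have hij : i = j := by simpa using hj
    exact hij ▸ h
  have hedge : ∀ i : Fin m, s(0, i.succ) ∈ (starGraph (0 : Fin (m + 1))).edgeSet := fun i => by
    simp [(Fin.succ_ne_zero i).symm]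
  have hidx : ∀ f : {f : Sym2 (Fin (m + 1)) // f ∈ F ∧ f ∈ (starGraph 0).edgeSet},
      ∃ i : Fin m, f.1 = s(0, i.succ) ∧ T (n i) ≠ n i := fun f => f.2.1
  choose g hg hgT using hidx
  -- Leaves of the star go to the outer ends of branches, subdividing vertices to the neighbours of
  -- `c`.
  let φ : Fin (m + 1) ⊕ {f : Sym2 (Fin (m + 1)) // f ∈ F ∧ f ∈ (starGraph 0).edgeSet} → V :=
    Sum.elim (Fin.cases c fun i => T (n i)) fun f => n (g f)
  have hφ0 : φ (Sum.inl 0) = c := rfl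
  have hφs : ∀ i : Fin m, φ (Sum.inl i.succ) = T (n i) := fun i => rfl
  have hφr : ∀ f, φ (Sum.inr f) = n (g f) := fun f => rfl
  have hinj : Function.Injective φ := by
    rintro (i | f) (j | f') h
    · refine congrArg Sum.inl ?_
      revert h
      refine Fin.cases ?_ (fun i => ?_) i <;> refine Fin.cases ?_ (fun j => ?_) j <;> intro h
      · rfl
      · exact absurd h.symm (hTc _ (hn j))
      · exact absurd h (hTc _ (hn i))
      · rw [hninj i j (hTinj _ _ (hn i) (hn j) h)]
    · exfalso
      revert h
      refine Fin.cases ?_ (fun i => ?_) i <;> intro h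
      · exact (hn (g f')).ne h
      · rw [hφs, hφr] at h
        have := hTnbr _ _ (hn i) (hn _) h
        rw [this] at h
        exact hgT f' h
    · exfalso
      revert h
      refine Fin.cases ?_ (fun j => ?_) j <;> intro h
      · exact (hn (g f)).ne h.symm
      · rw [hφs, hφr] at h
        have := hTnbr _ _ (hn j) (hn _) h.symm
        rw [this] at h
        exact hgT f h.symm
    · refine congrArg Sum.inr (Subtype.ext ?_)
      rw [hg f, hg f', hninj _ _ h]
  have hsurj : Function.Surjective φ := by
    intro v
    have hTs : ∀ a, G.Adj c a → ∃ w, φ w = T a := fun a ha => by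
      obtain ⟨i, rfl⟩ := hnsurj a ha
      exact ⟨Sum.inl i.succ, rfl⟩
    rcases hcover v with rfl | ⟨a, ha, rfl | rfl⟩
    · exact ⟨Sum.inl 0, rfl⟩
    · by_cases h : T v = v
      · rw [← h]
        exact hTs v ha
      · obtain ⟨i, rfl⟩ := hnsurj v ha
        refine ⟨Sum.inr ⟨s(0, i.succ), (hF i).mpr h, hedge i⟩, ?_⟩
        rw [hφr]
        have := hg ⟨s(0, i.succ), (hF i).mpr h, hedge i⟩
        have hi : i = g ⟨s(0, i.succ), (hF i).mpr h, hedge i⟩ := by simpa using this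
        rw [← hi]
    · exact hTs a ha
  have hcT : ∀ i, G.Adj c (T (n i)) ↔ T (n i) = n i := by
    intro i
    refine ⟨fun h => (hTnbr _ _ (hn i) h rfl).symm, fun h => by rw [h]; exact hn i⟩
  have hTT : ∀ i j, ¬ G.Adj (T (n i)) (T (n j)) := by
    intro i j h
    rcases hT _ (hn i) with ⟨h1, h2⟩ | ⟨h0, -, h1, h2, -⟩
    · rw [h1] at h
      exact hTc _ (hn j) (h2.eq_of_adj h (hn i).symm)
    · have h3 : T (n j) = n i := h2.eq_of_adj h h1.symm
      have h4 := hTnbr _ _ (hn j) (hn i) h3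
      rw [h4] at h3
      exact h0 h3
  have hTn : ∀ i f, G.Adj (T (n i)) (n (g f)) ↔ i = g f := by
    intro i f
    rcases hT _ (hn (g f)) with ⟨h, -⟩ | ⟨-, -, h1, -, h2⟩
    · exact absurd h (hgT f)
    · refine ⟨fun h => ?_, fun h => h ▸ h1.symm⟩
      rcases h2 _ h.symm with h3 | h3
      · exact absurd h3 (hTc _ (hn i))
      · exact hninj _ _ (hTinj _ _ (hn i) (hn _) h3)
  have hnn : ∀ i f, ¬ G.Adj (n i) (n (g f)) := by
    intro i f h
    rcases hT _ (hn (g f)) with ⟨h1, -⟩ | ⟨-, -, -, -, h2⟩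
    · exact hgT f h1
    · rcases h2 _ h.symm with h3 | h3
      · exact (hn i).ne h3.symm
      · have := hTnbr _ _ (hn (g f)) (hn i) h3.symm
        rw [this] at h
        exact h.ne rfl
  have hinlr : ∀ (i : Fin (m + 1)) f, G.Adj (φ (Sum.inl i)) (φ (Sum.inr f)) ↔ i ∈ f.1 := by
    intro i f
    rw [hg f]
    refine Fin.cases ?_ (fun i => ?_) i
    · rw [hφ0, hφr]
      simpa using hn (g f)
    · rw [hφs, hφr, hTn]
      simp [Fin.succ_ne_zero]
  have hmap : ∀ a b, G.Adj (φ a) (φ b) ↔ ((starGraph (0 : Fin (m + 1))).subdivide F).Adj a b := by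
    rintro (i | f) (j | f')
    · change _ ↔ (starGraph 0).Adj i j ∧ s(i, j) ∉ F
      refine Fin.cases ?_ (fun i => ?_) i <;> refine Fin.cases ?_ (fun j => ?_) j
      · simp
      · rw [hφ0, hφs, hcT, hF]
        simp [(Fin.succ_ne_zero j).symm]
      · rw [hφ0, hφs, G.adj_comm, hcT, Sym2.eq_swap, hF]
        simp [Fin.succ_ne_zero i]
      · rw [hφs, hφs]
        simp [hTT, Fin.succ_ne_zero]
    · exact hinlr i f'
    · rw [G.adj_comm]
      exact hinlr j f
    · exact iff_of_false (hnn _ f') id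
  -- The unsubdivided edge `e₀` is the branch of the end vertex `x₀`.
  refine ⟨m, s(0, i₀.succ), F, hedge i₀, ?_, ⟨RelIso.symm
    { toEquiv := Equiv.ofBijective φ ⟨hinj, hsurj⟩, map_rel_iff' := fun {a b} => hmap a b }⟩⟩
  rintro f ⟨i, rfl, hi⟩
  refine ⟨hedge i, fun h => hi ?_⟩
  have hii : i = i₀ := by simpa using h
  rw [hii, hi₀, hTx₀]

/-! ### Subdivided stars attain equality -/

lemma IsStarSubdividedAllButOneAtMostOnce.edgeCoverNum_le_nonlocalMetricDim_add_one [Finite V]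
    (hG : G.IsTree) (h : G.IsStarSubdividedAllButOneAtMostOnce) :
    G.edgeCoverNum ≤ G.nonlocalMetricDim + 1 := by
  classical
  obtain ⟨m, e₀, F, he₀, hF, ⟨ψ⟩⟩ := h
  have hstar : ∀ e ∈ (starGraph (0 : Fin (m + 1))).edgeSet, ∃ i : Fin m, e = s(0, i.succ) := by
    intro e
    refine Sym2.ind (fun i j h => ?_) e
    rw [mem_edgeSet, starGraph_adj] at h
    rcases h with ⟨hne, rfl | rfl⟩
    · obtain ⟨k, rfl⟩ := Fin.exists_succ_eq.mpr hne.symm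
      exact ⟨k, rfl⟩
    · obtain ⟨k, rfl⟩ := Fin.exists_succ_eq.mpr hne
      exact ⟨k, Sym2.eq_swap⟩
  have hedge : ∀ i : Fin m, s(0, i.succ) ∈ (starGraph (0 : Fin (m + 1))).edgeSet := fun i => by
    simp [(Fin.succ_ne_zero i).symm]
  let H := (starGraph (0 : Fin (m + 1))).subdivide F
  -- `a i` is the neighbour of the centre in branch `i`, and `t i` is the last edge of the branch.
  have hbranch : ∀ i : Fin m, ∃ a t, H.Adj (Sum.inl 0) a ∧ (a = Sum.inl i.succ ∨
      ∃ f, a = Sum.inr f ∧ f.1 = s(0, i.succ)) ∧ t ∈ H.edgeSet ∧ Sum.inl i.succ ∈ t ∧ a ∈ t ∧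
      (s(0, i.succ) ∉ F → Sum.inl 0 ∈ t) := by
    intro i
    by_cases hi : s(0, i.succ) ∈ F
    · refine ⟨Sum.inr ⟨_, hi, hedge i⟩, s(Sum.inl i.succ, Sum.inr ⟨_, hi, hedge i⟩), ?_,
        Or.inr ⟨_, rfl, rfl⟩, ?_, by simp, by simp, fun h => absurd hi h⟩
      · change (0 : Fin (m + 1)) ∈ s(0, i.succ)
        simp
      · change i.succ ∈ s(0, i.succ)
        simp
    · refine ⟨Sum.inl i.succ, s(Sum.inl 0, Sum.inl i.succ), ?_, Or.inl rfl, ?_, by simp, by simp,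
        by simp⟩ <;> exact ⟨hedge i, hi⟩
  choose a t ha hai ht hit hat h0t using hbranch
  have hainj : Function.Injective a := by
    intro i j hij
    rcases hai i with h | ⟨f, h, hf⟩ <;> rcases hai j with h' | ⟨f', h', hf'⟩ <;>
      rw [h, h'] at hij
    · simpa using hij
    · simp at hij
    · simp at hij
    · have hff : f = f' := by simpa using hij
      rw [hff, hf'] at hf
      exact (by simpa using hf : j = i).symm
  obtain ⟨X, hX, hXcard⟩ := exists_nonlocalResolvingSet_card_eq hG.connected
  have h1 : m ≤ X.card + 1 := by
    have := hG.isNonlocalResolvingSet_card_ge hX (c := ψ.symm (Sum.inl 0))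
      (N := Finset.univ.image fun i => ψ.symm (a i)) (by
        intro y hy
        obtain ⟨i, -, rfl⟩ := Finset.mem_image.mp hy
        exact ψ.symm.map_adj_iff.mpr (ha i))
    have hinj : Function.Injective fun i => ψ.symm (a i) := ψ.symm.injective.comp hainj
    rwa [Finset.card_image_of_injective _ hinj, Finset.card_univ, Fintype.card_fin] at this
  have hcov : G.IsEdgeCoverSet (Finset.univ.image fun i => (t i).map ψ.symm) := by
    constructor
    · intro e he
      obtain ⟨i, -, rfl⟩ := Finset.mem_image.mp he
      exact (ψ.symm.toHom.mapEdgeSet ⟨t i, ht i⟩).2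
    · intro v
      suffices h : ∃ i, ψ v ∈ t i by
        obtain ⟨i, hi⟩ := h
        refine ⟨_, Finset.mem_image_of_mem _ (Finset.mem_univ i), ?_⟩
        exact Sym2.mem_map.mpr ⟨_, hi, by simp⟩
      rcases ψ v with i | f
      · refine Fin.cases ?_ (fun i => ⟨i, hit i⟩) i
        -- The centre is covered because `e₀` is not subdivided.
        obtain ⟨i, rfl⟩ := hstar e₀ he₀
        exact ⟨i, h0t i fun h => (hF h).2 rfl⟩
      · obtain ⟨i, hi⟩ := hstar f.1 f.2.2
        refine ⟨i, ?_⟩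
        rcases hai i with h | ⟨f', h, hf'⟩
        · have := ha i
          rw [h] at this
          exact absurd (hi ▸ f.2.1) this.2
        · rw [(Subtype.ext (hi.trans hf'.symm) : f = f'), ← h]
          exact hat i
  have h2 := edgeCoverNum_le hcov
  have h3 : (Finset.univ.image fun i => (t i).map ψ.symm).card ≤ m := by
    simpa using Finset.card_image_le (s := Finset.univ) (f := fun i => (t i).map ψ.symm)
  omega

end SimpleGraph

theorem mainTheorem5 {V : Type*} [Finite V] [Nontrivial V] (G : SimpleGraph V)
    (hconn : G.Connected) (hgirth : 7 ≤ G.egirth) :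
    (G.nonlocalMetricDim : ℤ) ≤ (G.edgeCoverNum : ℤ) - 1 ∧
      (G.IsTree →
        ((G.nonlocalMetricDim : ℤ) = (G.edgeCoverNum : ℤ) - 1 ↔
          G.IsStarSubdividedAllButOneAtMostOnce)) := by
  have hle := SimpleGraph.nonlocalMetricDim_add_one_le_edgeCoverNum hconn hgirth
  refine ⟨by omega, fun hG => ⟨fun h => ?_, fun h => ?_⟩⟩
  · obtain ⟨hstr, hmaj⟩ := hG.structure_of_nonlocalMetricDim_add_one_eq (by omega)
    obtain ⟨c, ⟨x, hcx, hx⟩, hc⟩ := hconn.exists_centre hstr hmaj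
    exact hconn.isStarSubdividedAllButOneAtMostOnce hcx hx hc
  · have := h.edgeCoverNum_le_nonlocalMetricDim_add_one hG
    omega
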